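/- Throughout, a multigraph is finite and has no loops (parallel edges are allowed). It is $d$-regular if every vertex is incident with exactly $d$ edges. Its adjacency matrix has as $(x,y)$ entry the number of edges joining $x$ and $y$, and $\lambda_2(G)$ is the second-largest eigenvalue (with multiplicity) of the adjacency matrix of $G$. The edge-connectivity $\kappa'(G)$ is the least number of edges whose removal leaves a disconnected multigraph (so $\kappa'(G)=0$ if $G$ is disconnected). For integers $d\ge 1$ and $n\ge 5$ let $$Q=\begin{pmatrix} \frac{d+1}{2} & \frac{d-1}{2} & 0 & 0\\ d-1 & 0 & 1 & 0\\ 0 & 1 & 0 & d-1\\ 0 & 0 & \frac{d-1}{n-4} & d-\frac{d-1}{n-4}\end{pmatrix}.$$ All eigenvalues of $Q$ are real; let $\rho(d,n)$ be the second-largest one, counted with multiplicity. **Theorem.** Let $d\ge 1$ and $n\ge 5$, and let $G$ be an $n$-vertex $d$-regular multigraph with $\lambda_2(G)<\rho(d,n)$. Then $\kappa'(G)\ge 2$. This improves the bound $d-\frac13-\frac1{n-3}$: one has $\rho(d,n)>d-\frac13-\frac1{n-3}$ for all $d\ge1$, $n\ge5$. It is also sharp for $n=6$: if $d\ge 3$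 and $G$ is a $6$-vertex $d$-regular multigraph with $\kappa'(G)=1$, then $\lambda_2(G)=\rho(d,6)=\frac14\left(d-1+\sqrt{9d^2-10d+17}\right)$; and such a multigraph exists for every odd $d\ge3$. -/

import Mathlib

/-!
Finite multigraphs without loops are Mathlib's `Graph α β` (vertex set in `α`, edge set in `β`,
parallel edges allowed) together with `Graph.Loopless` and a finite vertex set.
-/

noncomputable section

/-- The second-largest eigenvalue of a real square matrix: the entry of index `1` (counting from
`0`) in the list of the real roots of the characteristic polynomial, repeated according to
multiplicity and sorted in non-increasing order. (If there are fewer than two real eigenvalues,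
the value is `0`.) -/
def secondLargestEigenvalue {ι : Type*} [Fintype ι] [DecidableEq ι] (M : Matrix ι ι ℝ) : ℝ :=
  (M.charpoly.roots.sort (· ≥ ·)).getD 1 0

namespace Graph

variable {α β : Type*}

/-- `G` is `d`-regular: each vertex is incident with exactly `d` edges. (This is the degree
for graphs without loops.) -/
def IsDRegular (G : Graph α β) (d : ℕ) : Prop :=
  ∀ x ∈ G.vertexSet, (G.incidenceSet x).encard = d

/-- The adjacency matrix of `G`: the entry at `(x, y)` is the number of edges
between `x` and `y`. -/
def adjacencyMatrix (G : Graph α β) : Matrix G.vertexSet G.vertexSet ℝ :=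
  Matrix.of fun x y => ({e | G.IsLink e x y}.ncard : ℝ)

open Classical in
/-- `λ₂(G)`, the second-largest eigenvalue of the adjacency matrix. -/
def lambda2 (G : Graph α β) [Fintype G.vertexSet] : ℝ :=
  secondLargestEigenvalue G.adjacencyMatrix

/-- A set `F` of edges of `G` is disconnecting if `G - F` is not connected. Connectedness of a
multigraph is that of its underlying simple graph. -/
def IsDisconnecting (G : Graph α β) (F : Set β) : Prop :=
  F ⊆ G.edgeSet ∧ ¬ (G.deleteEdges F).toSimpleGraph.Connected

/-- The edge-connectivity `κ'(G)`: the smallest size of a disconnecting set of edges. It is `0`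
for a disconnected graph (and `⊤` by convention for a graph with only one vertex). -/
def edgeConnectivity (G : Graph α β) : ℕ∞ :=
  sInf {k | ∃ F : Set β, G.IsDisconnecting F ∧ F.encard = k}

end Graph

/-- The `4 × 4` matrix `Q` depending on `d` and `n`. -/
def matrixQ (d n : ℕ) : Matrix (Fin 4) (Fin 4) ℝ :=
  !![((d : ℝ) + 1) / 2, ((d : ℝ) - 1) / 2, 0, 0;
     (d : ℝ) - 1, 0, 1, 0;
     0, 1, 0, (d : ℝ) - 1;
     0, 0, ((d : ℝ) - 1) / ((n : ℝ) - 4), (d : ℝ) - ((d : ℝ) - 1) / ((n : ℝ) - 4)]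

/-- `ρ(d, n)`, the second-largest eigenvalue of `Q`. -/
def rho (d n : ℕ) : ℝ := secondLargestEigenvalue (matrixQ d n)

end

/-! Suppose `κ' < 2`. Then the vertices split into `S` and its complement with at most one edge
between them. If no edge crosses, the indicator of `S` is an eigenvector for `d`, so `λ₂ ≥ d ≥ ρ`.
Otherwise a single edge `uv` crosses, and `Q` is the quotient matrix of the partition `S \ {u}`,
`{u}`, `{v}`, `Sᶜ \ {v}` in the case `|S| = 3`.

The eigenvector of `Q` for `ρ` gives a function on the vertices that is constant on these classes.
The energy `d‖f‖² - fᵀAf` of such a function depends only on its four values, not on `|S|` or on how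
the edges lie inside each side (`IsBridgeCut.quadratic_form`). If the smaller side has more than
three vertices, keeping the four values leaves the energy fixed and does not decrease the variance
(`exists_test_vector`). The Rayleigh quotient of `d - A` on nonconstant functions therefore stays at
most `d - ρ`, and Courant–Fischer gives `λ₂ ≥ ρ`.

The number `d - ρ` is the least root of an explicit cubic (`rho_spec`); a sign change of that cubic
gives the comparison with the earlier bound (`lt_rho`). For `n = 6` both sides are triangles with
forced multiplicities, the cubic factors, and the form of `d - A` on vectors of sum zero splits into
explicit nonnegative pieces (`six_vertex_form_le`), so `λ₂ ≤ ρ` as well. -/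

noncomputable section

open Matrix

/-! ### Courant–Fischer bounds for the second eigenvalue. -/

section Spectral

variable {ι : Type*} [Fintype ι] [DecidableEq ι] {M : Matrix ι ι ℝ}

lemma secondLargestEigenvalue_eq_eigenvalues₀ (hM : M.IsHermitian) (hι : 1 < Fintype.card ι) :
    secondLargestEigenvalue M = hM.eigenvalues₀ ⟨1, hι⟩ := by
  have h := hM.sort_roots_charpoly_eq_eigenvalues₀
  simp only [RCLike.re_to_real, Multiset.map_id'] at h
  rw [secondLargestEigenvalue, h, List.getD_eq_getElem _ _ (by simpa using hι)]
  simp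

lemma eigenvectorBasis_sum_dotProduct (hM : M.IsHermitian) (x y : ι → ℝ) :
    ∑ i, (hM.eigenvectorBasis i).ofLp ⬝ᵥ x * (hM.eigenvectorBasis i).ofLp ⬝ᵥ y = x ⬝ᵥ y := by
  have h := hM.eigenvectorBasis.sum_inner_mul_inner (WithLp.toLp 2 x) (WithLp.toLp 2 y)
  simp only [EuclideanSpace.inner_eq_star_dotProduct, star_trivial] at h
  rw [dotProduct_comm x y, ← h]
  exact Finset.sum_congr rfl fun i _ => by rw [dotProduct_comm y]

lemma dotProduct_mulVec_eq_sum_eigenvalues (hM : M.IsHermitian) (x : ι → ℝ) :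
    x ⬝ᵥ M *ᵥ x =
      ∑ i, hM.eigenvalues i * ((hM.eigenvectorBasis i).ofLp ⬝ᵥ x) ^ 2 := by
  rw [← eigenvectorBasis_sum_dotProduct hM]
  refine Finset.sum_congr rfl fun i _ => ?_
  have hT : Mᵀ = M := by rw [← conjTranspose_eq_transpose_of_trivial]; exact hM
  have : (hM.eigenvectorBasis i).ofLp ⬝ᵥ M *ᵥ x =
      hM.eigenvalues i * (hM.eigenvectorBasis i).ofLp ⬝ᵥ x := by
    rw [dotProduct_mulVec, ← mulVec_transpose, hT, hM.mulVec_eigenvectorBasis, smul_dotProduct,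
      smul_eq_mul]
  rw [this]
  ring

/-- The quadratic form of `M` is at least `c` on a plane, so `M` has two eigenvalues `≥ c`. -/
lemma le_secondLargestEigenvalue (hM : M.IsHermitian) (hι : 1 < Fintype.card ι) {c : ℝ}
    (f g : ι → ℝ) (hfg : ∀ a b : ℝ, a • f + b • g = 0 → a = 0 ∧ b = 0)
    (h : ∀ a b : ℝ, c * ((a • f + b • g) ⬝ᵥ (a • f + b • g)) ≤
      (a • f + b • g) ⬝ᵥ M *ᵥ (a • f + b • g)) :
    c ≤ secondLargestEigenvalue M := by
  rw [secondLargestEigenvalue_eq_eigenvalues₀ hM hι]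
  -- `eigenvalues` is `eigenvalues₀`, which is sorted, reindexed along `σ`; so `i₀` carries the
  -- largest eigenvalue.
  set σ := Fintype.equivOfCardEq (Fintype.card_fin (Fintype.card ι)) with hσ
  set i₀ : ι := σ ⟨0, by omega⟩ with hi₀
  set v := (hM.eigenvectorBasis i₀).ofLp with hv
  -- A plane contains a nonzero vector orthogonal to the top eigenvector; only eigenvalues from the
  -- second on contribute to its quadratic form.
  obtain ⟨a, b, hab, hz⟩ : ∃ a b : ℝ, ¬ (a = 0 ∧ b = 0) ∧ v ⬝ᵥ (a • f + b • g) = 0 := by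
    by_cases h0 : v ⬝ᵥ f = 0
    · exact ⟨1, 0, by simp, by simp [h0]⟩
    · refine ⟨-(v ⬝ᵥ g), v ⬝ᵥ f, by simp [h0], ?_⟩
      simp only [dotProduct_add, dotProduct_smul, smul_eq_mul]
      ring
  set z := a • f + b • g with hzdef
  have hz0 : z ≠ 0 := fun h0 => hab (hfg a b h0)
  have hpos : 0 < z ⬝ᵥ z := by
    refine lt_of_le_of_ne (Finset.sum_nonneg fun i _ => mul_self_nonneg _) fun h0 => hz0 ?_
    exact dotProduct_self_eq_zero.1 h0.symm
  refine le_of_mul_le_mul_right ((h a b).trans ?_) hpos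
  rw [← hzdef, dotProduct_mulVec_eq_sum_eigenvalues hM, ← eigenvectorBasis_sum_dotProduct hM z z,
    Finset.mul_sum]
  refine Finset.sum_le_sum fun i _ => ?_
  by_cases hi : i = i₀
  · subst hi
    rw [← hv, hz]
    simp
  · rw [← sq]
    refine mul_le_mul_of_nonneg_right (hM.eigenvalues₀_antitone ?_) (sq_nonneg _)
    rw [Fin.le_def]
    by_contra hlt
    refine hi ?_
    rw [hi₀, ← Equiv.symm_apply_eq]
    ext
    simp only [← hσ] at hlt ⊢
    omega

/-- The quadratic form of `M` is at most `c` on a hyperplane, so at most one eigenvalue of `M`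
exceeds `c`. -/
lemma secondLargestEigenvalue_le (hM : M.IsHermitian) (hι : 1 < Fintype.card ι) {c : ℝ}
    (w : ι → ℝ) (h : ∀ z, w ⬝ᵥ z = 0 → z ⬝ᵥ M *ᵥ z ≤ c * (z ⬝ᵥ z)) :
    secondLargestEigenvalue M ≤ c := by
  rw [secondLargestEigenvalue_eq_eigenvalues₀ hM hι]
  set σ := Fintype.equivOfCardEq (Fintype.card_fin (Fintype.card ι)) with hσ
  set i₀ : ι := σ ⟨0, by omega⟩ with hi₀
  set i₁ : ι := σ ⟨1, by omega⟩ with hi₁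
  have hne : i₀ ≠ i₁ := fun h0 => by simpa using σ.injective h0
  set B := hM.eigenvectorBasis with hB
  have horth : ∀ i j, (B i).ofLp ⬝ᵥ (B j).ofLp = if i = j then 1 else 0 := fun i j => by
    have := orthonormal_iff_ite.1 B.orthonormal j i
    rw [EuclideanSpace.inner_eq_star_dotProduct, star_trivial] at this
    rw [this]
    simp [eq_comm]
  -- Dually, the span of the top two eigenvectors meets the hyperplane `w ⬝ᵥ z = 0` in a nonzero
  -- vector.
  obtain ⟨a, b, hab, hz⟩ : ∃ a b : ℝ, ¬ (a = 0 ∧ b = 0) ∧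
      w ⬝ᵥ (a • (B i₀).ofLp + b • (B i₁).ofLp) = 0 := by
    by_cases h0 : w ⬝ᵥ (B i₀).ofLp = 0
    · exact ⟨1, 0, by simp, by simp [h0]⟩
    · refine ⟨-(w ⬝ᵥ (B i₁).ofLp), w ⬝ᵥ (B i₀).ofLp, by simp [h0], ?_⟩
      simp only [dotProduct_add, dotProduct_smul, smul_eq_mul]
      ring
  set z := a • (B i₀).ofLp + b • (B i₁).ofLp with hzdef
  have hc : ∀ i, (B i).ofLp ⬝ᵥ z = if i = i₀ then a else if i = i₁ then b else 0 := fun i => by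
    simp only [hzdef, dotProduct_add, dotProduct_smul, smul_eq_mul, horth]
    split_ifs with h1 h2 <;> simp_all
  have hzz : z ⬝ᵥ z = a ^ 2 + b ^ 2 := by
    rw [hzdef]
    simp only [dotProduct_add, add_dotProduct, dotProduct_smul, smul_dotProduct, smul_eq_mul,
      horth, if_neg hne, if_neg hne.symm, if_true]
    ring
  have hpos : 0 < z ⬝ᵥ z := by
    rw [hzz]
    rcases not_and_or.1 hab with h0 | h0 <;> positivity
  refine le_of_mul_le_mul_right (le_trans ?_ (h z hz)) hpos
  rw [dotProduct_mulVec_eq_sum_eigenvalues hM, ← eigenvectorBasis_sum_dotProduct hM z z,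
    Finset.mul_sum]
  refine Finset.sum_le_sum fun i _ => ?_
  rw [← sq]
  have key : i = i₀ ∨ i = i₁ → hM.eigenvalues₀ ⟨1, hι⟩ ≤ hM.eigenvalues i := fun hi => by
    refine hM.eigenvalues₀_antitone ?_
    rw [Fin.le_def, ← hσ]
    rcases hi with rfl | rfl
    · simp [hi₀]
    · simp [hi₁]
  by_cases hi : i = i₀ ∨ i = i₁
  · exact mul_le_mul_of_nonneg_right (key hi) (sq_nonneg _)
  · rw [← hB, hc, if_neg fun h => hi (.inl h), if_neg fun h => hi (.inr h)]
    simp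

/-- A factor `X - r` with `r` at least all the other roots can be removed. -/
lemma secondLargestEigenvalue_of_charpoly_eq {r : ℝ} {q : Polynomial ℝ}
    (hq : M.charpoly = (Polynomial.X - Polynomial.C r) * q) (hr : ∀ s ∈ q.roots, s ≤ r)
    (hne : q.roots ≠ 0) :
    secondLargestEigenvalue M ∈ q.roots ∧ ∀ s ∈ q.roots, s ≤ secondLargestEigenvalue M := by
  have hroots : M.charpoly.roots = r ::ₘ q.roots := by
    rw [hq, Polynomial.roots_mul (hq ▸ M.charpoly_monic.ne_zero), Polynomial.roots_X_sub_C,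
      Multiset.singleton_add]
  have hsort : M.charpoly.roots.sort (· ≥ ·) = r :: q.roots.sort (· ≥ ·) := by
    rw [hroots]
    exact Multiset.sort_cons _ _ _ hr
  rw [secondLargestEigenvalue, hsort]
  have hp := Multiset.pairwise_sort q.roots (· ≥ ·)
  have hm : ∀ s, s ∈ q.roots.sort (· ≥ ·) ↔ s ∈ q.roots := fun s => Multiset.mem_sort _
  rcases hl : q.roots.sort (· ≥ ·) with _ | ⟨t, l⟩
  · refine absurd (Multiset.eq_zero_of_forall_notMem fun s hs => ?_) hne
    simpa [hl] using (hm s).2 hs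
  · rw [hl] at hp hm
    simp only [List.getD_cons_succ, List.getD_cons_zero]
    refine ⟨(hm t).1 (by simp), fun s hs => ?_⟩
    rcases List.mem_cons.1 ((hm s).2 hs) with rfl | h
    · exact le_rfl
    · exact (List.pairwise_cons.1 hp).1 s h

end Spectral

/-! ### The spectrum of `Q` and estimates for `ρ(d, n)`. -/

section QuotientMatrix

open Polynomial

lemma charpoly_tridiagonal (a₀ a₁ a₂ a₃ b₀ b₁ b₂ c₀ c₁ c₂ : ℝ) :
    (!![a₀, b₀, 0, 0; c₀, a₁, b₁, 0; 0, c₁, a₂, b₂; 0, 0, c₂, a₃] :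
      Matrix (Fin 4) (Fin 4) ℝ).charpoly =
      (X - C a₀) * (X - C a₁) * (X - C a₂) * (X - C a₃)
        - C (b₀ * c₀) * (X - C a₂) * (X - C a₃) - C (b₁ * c₁) * (X - C a₀) * (X - C a₃)
        - C (b₂ * c₂) * (X - C a₀) * (X - C a₁) + C (b₀ * c₀) * C (b₂ * c₂) := by
  rw [Matrix.charpoly, Matrix.det_succ_row_zero]
  simp [Fin.sum_univ_succ, Matrix.det_fin_three, Matrix.charmatrix_apply, Fin.succAbove]
  ring

/-- The characteristic polynomial involves the off-diagonal entries only through the products `bᵢ *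
cᵢ`, so replacing each pair by `√(bᵢ * cᵢ)` gives a symmetric matrix with the same polynomial. -/
lemma splits_charpoly_tridiagonal (a₀ a₁ a₂ a₃ : ℝ) {b₀ b₁ b₂ c₀ c₁ c₂ : ℝ}
    (h₀ : 0 ≤ b₀ * c₀) (h₁ : 0 ≤ b₁ * c₁) (h₂ : 0 ≤ b₂ * c₂) :
    (!![a₀, b₀, 0, 0; c₀, a₁, b₁, 0; 0, c₁, a₂, b₂; 0, 0, c₂, a₃] :
      Matrix (Fin 4) (Fin 4) ℝ).charpoly.Splits := by
  have hS : (!![a₀, √(b₀ * c₀), 0, 0; √(b₀ * c₀), a₁, √(b₁ * c₁), 0;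
      0, √(b₁ * c₁), a₂, √(b₂ * c₂); 0, 0, √(b₂ * c₂), a₃] :
      Matrix (Fin 4) (Fin 4) ℝ).IsHermitian := by
    ext i j
    fin_cases i <;> fin_cases j <;> simp
  have h := hS.splits_charpoly
  rw [charpoly_tridiagonal, Real.mul_self_sqrt h₀, Real.mul_self_sqrt h₁,
    Real.mul_self_sqrt h₂] at h
  rwa [charpoly_tridiagonal]

lemma matrixQ_charpoly_splits {d n : ℕ} (hd : 1 ≤ d) (hn : 5 ≤ n) :
    (matrixQ d n).charpoly.Splits := by
  have hd' : (0 : ℝ) ≤ d - 1 := by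
    have : (1 : ℝ) ≤ d := by exact_mod_cast hd
    linarith
  have hn' : (0 : ℝ) ≤ n - 4 := by
    have : (5 : ℝ) ≤ n := by exact_mod_cast hn
    linarith
  exact splits_charpoly_tridiagonal _ _ _ _ (by positivity) (by norm_num) (by positivity)

/-- Up to a constant factor, the nonzero eigenvalues of `d - Q` are the roots of this cubic,
where `m = n - 4` and `e = d - 1`. -/
def gapCubic (m e μ : ℝ) : ℝ :=
  2 * m * μ ^ 3 - (4 * m + (5 * m + 2) * e) * μ ^ 2 +
    (3 * (m + 1) * e ^ 2 + (6 * m + 4) * e) * μ - (m + 4) * e ^ 2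

lemma gapCubic_neg {m e μ : ℝ} (hm : 0 < m) (he : 0 ≤ e) (hμ : μ < 0) : gapCubic m e μ < 0 := by
  have h : 0 < -μ := by linarith
  have : gapCubic m e μ = -(2 * m * (-μ) ^ 3 + (4 * m + (5 * m + 2) * e) * (-μ) ^ 2 +
    (3 * (m + 1) * e ^ 2 + (6 * m + 4) * e) * (-μ) + (m + 4) * e ^ 2) := by
    rw [gapCubic]; ring
  rw [this, neg_lt_zero]
  positivity

/-- The cofactor of `X - d` in the characteristic polynomial of `Q`. -/
def cubicFactor (d n : ℕ) : ℝ[X] :=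
  C (-1 / (2 * ((n : ℝ) - 4))) *
    (C (2 * ((n : ℝ) - 4)) * (C (d : ℝ) - X) ^ 3
      - C (4 * ((n : ℝ) - 4) + (5 * ((n : ℝ) - 4) + 2) * ((d : ℝ) - 1)) * (C (d : ℝ) - X) ^ 2
      + C (3 * ((n : ℝ) - 4 + 1) * ((d : ℝ) - 1) ^ 2 + (6 * ((n : ℝ) - 4) + 4) * ((d : ℝ) - 1))
        * (C (d : ℝ) - X)
      - C (((n : ℝ) - 4 + 4) * ((d : ℝ) - 1) ^ 2))

lemma eval_cubicFactor (d n : ℕ) (x : ℝ) :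
    (cubicFactor d n).eval x =
      -1 / (2 * ((n : ℝ) - 4)) * gapCubic ((n : ℝ) - 4) ((d : ℝ) - 1) (d - x) := by
  simp only [cubicFactor, gapCubic, eval_mul, eval_C, eval_add, eval_sub, eval_pow, eval_X]

lemma matrixQ_charpoly {d n : ℕ} (hn : 5 ≤ n) :
    (matrixQ d n).charpoly = (X - C (d : ℝ)) * cubicFactor d n := by
  have hn' : (n : ℝ) - 4 ≠ 0 := by
    have : (5 : ℝ) ≤ n := by exact_mod_cast hn
    linarith
  refine Polynomial.funext fun x => ?_
  rw [eval_mul, eval_cubicFactor, matrixQ, charpoly_tridiagonal, gapCubic]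
  simp only [eval_mul, eval_C, eval_add, eval_sub, eval_X]
  field_simp
  ring

/-- The cubic is negative at negative arguments, so no root of the cofactor of `X - d` exceeds `d`.
Removing the root `d` thus leaves `ρ` as the largest root of the cofactor, and `x ↦ d - x` reverses
the order. -/
lemma rho_spec {d n : ℕ} (hd : 1 ≤ d) (hn : 5 ≤ n) :
    gapCubic ((n : ℝ) - 4) ((d : ℝ) - 1) (d - rho d n) = 0 ∧
      ∀ μ, gapCubic ((n : ℝ) - 4) ((d : ℝ) - 1) μ = 0 → d - rho d n ≤ μ := by
  have hd' : (0 : ℝ) ≤ d - 1 := by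
    have : (1 : ℝ) ≤ d := by exact_mod_cast hd
    linarith
  have hn' : (0 : ℝ) < n - 4 := by
    have : (5 : ℝ) ≤ n := by exact_mod_cast hn
    linarith
  have hq := matrixQ_charpoly (d := d) hn
  have hprod : (X - C (d : ℝ)) * cubicFactor d n ≠ 0 := hq ▸ (matrixQ d n).charpoly_monic.ne_zero
  have hroot : ∀ x, x ∈ (cubicFactor d n).roots ↔
      gapCubic ((n : ℝ) - 4) ((d : ℝ) - 1) (d - x) = 0 := fun x => by
    rw [mem_roots (right_ne_zero_of_mul hprod), IsRoot.def, eval_cubicFactor, mul_eq_zero,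
      or_iff_right (div_ne_zero (by norm_num) (by positivity))]
  have hcard := splits_iff_card_roots.1 (matrixQ_charpoly_splits hd hn)
  rw [hq, roots_mul hprod, roots_X_sub_C, Multiset.card_add, Multiset.card_singleton, ← hq,
    Matrix.charpoly_natDegree_eq_dim, Fintype.card_fin] at hcard
  obtain ⟨h₁, h₂⟩ := secondLargestEigenvalue_of_charpoly_eq hq (fun s hs => by
    by_contra! hlt
    exact (gapCubic_neg hn' hd' (sub_neg.2 hlt)).ne ((hroot s).1 hs)) (fun h0 => by
    simp [h0] at hcard)
  refine ⟨(hroot _).1 h₁, fun μ hμ => ?_⟩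
  have := h₂ (d - μ) ((hroot _).2 (by simpa using hμ))
  rw [rho]
  linarith

lemma rho_le {d n : ℕ} (hd : 1 ≤ d) (hn : 5 ≤ n) : rho d n ≤ d := by
  have hd' : (0 : ℝ) ≤ d - 1 := by
    have : (1 : ℝ) ≤ d := by exact_mod_cast hd
    linarith
  have hn' : (0 : ℝ) < n - 4 := by
    have : (5 : ℝ) ≤ n := by exact_mod_cast hn
    linarith
  by_contra! hlt
  exact (gapCubic_neg hn' hd' (sub_neg.2 hlt)).ne (rho_spec hd hn).1

/-- The cubic is negative at `0` and positive at `1/3 + 1/(m + 1)` when `d ≥ 2`, so it has a root in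
between. The point `1/3 + 1/(m + 1)` is where the coefficient of `e ^ 2` linear in `μ`, namely `3(m
+ 1)μ - (m + 4)`, vanishes. -/
lemma lt_rho {d n : ℕ} (hd : 1 ≤ d) (hn : 5 ≤ n) :
    (d : ℝ) - 1 / 3 - 1 / ((n : ℝ) - 3) < rho d n := by
  have hd' : (0 : ℝ) ≤ d - 1 := by
    have : (1 : ℝ) ≤ d := by exact_mod_cast hd
    linarith
  have hn' : (1 : ℝ) ≤ n - 4 := by
    have : (5 : ℝ) ≤ n := by exact_mod_cast hn
    linarith
  obtain ⟨-, hmin⟩ := rho_spec hd hn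
  have hn3 : (n : ℝ) - 3 = (n - 4 : ℝ) + 1 := by ring
  rw [hn3]
  set m : ℝ := (n : ℝ) - 4 with hm
  set e : ℝ := (d : ℝ) - 1 with he
  set μ₀ : ℝ := 1 / 3 + 1 / (m + 1) with hμ₀
  have hμpos : 0 < μ₀ := by positivity
  suffices h : ∃ μ < μ₀, gapCubic m e μ = 0 by
    obtain ⟨μ, hlt, h0⟩ := h
    have := hmin μ h0
    linarith
  -- For `d = 1` the cubic is not negative at `0`: it vanishes there, and `0` itself is the required
  -- root.
  rcases hd.eq_or_lt with h1 | h1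
  · have he0 : e = 0 := by rw [he, ← h1]; norm_num
    exact ⟨0, hμpos, by simp [gapCubic, he0]⟩
  have he1 : 1 ≤ e := by
    have : (2 : ℝ) ≤ d := by exact_mod_cast h1
    linarith
  have hneg : gapCubic m e 0 < 0 := by
    have : 0 < (m + 4) * e ^ 2 := by positivity
    simp only [gapCubic]
    linarith
  have hmul : 3 * (m + 1) * μ₀ = m + 4 := by rw [hμ₀]; field_simp; ring
  have hposv : 0 < gapCubic m e μ₀ := by
    have : gapCubic m e μ₀ =
        μ₀ * (2 * m * μ₀ ^ 2 - 4 * m * μ₀ - (5 * m + 2) * e * μ₀ + (6 * m + 4) * e) := by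
      rw [gapCubic]
      linear_combination e ^ 2 * hmul
    rw [this]
    refine mul_pos hμpos ?_
    refine pos_of_mul_pos_right (a := m + 1) ?_ (by positivity)
    have h1 : 0 ≤ m * (m + 4) * μ₀ := by positivity
    have h2 : 0 ≤ (13 * m ^ 2 + 8 * m + 4) * (e - 1) :=
      mul_nonneg (by positivity) (by linarith)
    have h3 : (m + 1) * (2 * m * μ₀ ^ 2 - 4 * m * μ₀ - (5 * m + 2) * e * μ₀ + (6 * m + 4) * e) =
        2 / 3 * (m * (m + 4) * μ₀) + 1 / 3 * ((13 * m ^ 2 + 8 * m + 4) * (e - 1))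
          + (3 * m ^ 2 - 8 / 3 * m + 4 / 3) := by
      linear_combination (2 * m * μ₀ / 3 - 4 * m / 3 - (5 * m + 2) * e / 3) * hmul
    rw [h3]
    nlinarith [sq_nonneg (m - 4 / 9)]
  have hcont : Continuous (gapCubic m e) := by unfold gapCubic; fun_prop
  obtain ⟨μ, ⟨-, hle⟩, h0⟩ := intermediate_value_Icc hμpos.le hcont.continuousOn
    (show (0 : ℝ) ∈ Set.Icc _ _ from ⟨hneg.le, hposv.le⟩)
  exact ⟨μ, lt_of_le_of_ne hle fun h => hposv.ne' (h ▸ h0), h0⟩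

/-- At `m = 2` the cubic has the factor `2μ - 3e`, whose root is excluded because `d - ρ < 2/3`. -/
lemma rho_six_quadratic {d : ℕ} (hd : 3 ≤ d) :
    2 * ((d : ℝ) - rho d 6) ^ 2 - (3 * ((d : ℝ) - 1) + 4) * (d - rho d 6)
      + 2 * ((d : ℝ) - 1) = 0 := by
  have h0 := (rho_spec (by omega : 1 ≤ d) (by norm_num : 5 ≤ 6)).1
  have h1 := lt_rho (by omega : 1 ≤ d) (by norm_num : 5 ≤ 6)
  have hd' : (3 : ℝ) ≤ d := by exact_mod_cast hd
  norm_num at h1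
  have h2 : (2 * ((d : ℝ) - rho d 6) - 3 * ((d : ℝ) - 1)) * (2 * ((d : ℝ) - rho d 6) ^ 2 -
      (3 * ((d : ℝ) - 1) + 4) * (d - rho d 6) + 2 * ((d : ℝ) - 1)) = 0 := by
    rw [← h0, gapCubic]
    push_cast
    ring
  exact (mul_eq_zero.1 h2).resolve_left (by linarith)

lemma rho_six {d : ℕ} (hd : 3 ≤ d) :
    rho d 6 = ((d : ℝ) - 1 + √(9 * (d : ℝ) ^ 2 - 10 * (d : ℝ) + 17)) / 4 := by
  have h0 := rho_six_quadratic hd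
  have h1 := lt_rho (by omega : 1 ≤ d) (by norm_num : 5 ≤ 6)
  have hd' : (3 : ℝ) ≤ d := by exact_mod_cast hd
  norm_num at h1
  have h2 : 9 * (d : ℝ) ^ 2 - 10 * (d : ℝ) + 17 = (4 * rho d 6 - (d - 1)) ^ 2 := by
    linear_combination -8 * h0
  rw [h2, Real.sqrt_sq (by linarith)]
  ring

end QuotientMatrix

/-! ### Regular multigraphs as matrices of multiplicities. -/

section RegularMatrix

variable {V : Type*} [Fintype V]

/-- `a x y` is the number of edges between `x` and `y` in a loopless `d`-regular multigraph. -/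
structure IsRegularMultiplicity (a : V → V → ℕ) (d : ℕ) : Prop where
  symm : ∀ x y, a x y = a y x
  diag : ∀ x, a x x = 0
  row : ∀ x, ∑ y, a x y = d

/-- The real matrix with the entries `a x y`. -/
def multiplicityMatrix (a : V → V → ℕ) : Matrix V V ℝ := Matrix.of fun x y => (a x y : ℝ)

namespace IsRegularMultiplicity

variable {a : V → V → ℕ} {d : ℕ}

lemma isHermitian (ha : IsRegularMultiplicity a d) : (multiplicityMatrix a).IsHermitian := by
  ext x y
  simp [multiplicityMatrix, ha.symm x y]

lemma mulVec_one (ha : IsRegularMultiplicity a d) :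
    multiplicityMatrix a *ᵥ 1 = (d : ℝ) • 1 := by
  ext x
  simp [multiplicityMatrix, mulVec, dotProduct, ← ha.row x]

end IsRegularMultiplicity

variable [DecidableEq V]

/-- If `1` is an eigenvector of `A` for `d`, a nonconstant `f` with small Rayleigh quotient
for `d - A` shows that the second eigenvalue of `A` is large. -/
lemma sub_le_secondLargestEigenvalue {A : Matrix V V ℝ} (hA : A.IsHermitian) {d μ : ℝ}
    (hrow : A *ᵥ 1 = d • 1) (f : V → ℝ) {p q : V} (hpq : f p ≠ f q) (hμ : 0 ≤ μ)
    (h : Fintype.card V * (d * (f ⬝ᵥ f) - f ⬝ᵥ A *ᵥ f) ≤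
      μ * (Fintype.card V * (f ⬝ᵥ f) - (1 ⬝ᵥ f) ^ 2)) :
    d - μ ≤ secondLargestEigenvalue A := by
  have hcard : 1 < Fintype.card V := Fintype.one_lt_card_iff.2 ⟨p, q, fun h0 => hpq (h0 ▸ rfl)⟩
  have hn : (0 : ℝ) < Fintype.card V := by positivity
  refine le_secondLargestEigenvalue hA hcard 1 f (fun a b hab => ?_) fun a b => ?_
  · have h1 := congrFun hab p
    have h2 := congrFun hab q
    simp only [Pi.add_apply, Pi.smul_apply, Pi.one_apply, smul_eq_mul, Pi.zero_apply] at h1 h2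
    have h3 : b * (f p - f q) = 0 := by linarith
    have hb : b = 0 := (mul_eq_zero.1 h3).resolve_right (sub_ne_zero.2 hpq)
    subst hb
    simpa using h1
  · have hT : Aᵀ = A := by rw [← conjTranspose_eq_transpose_of_trivial]; exact hA
    have h1 : (1 : V → ℝ) ⬝ᵥ A *ᵥ f = d * (1 ⬝ᵥ f) := by
      rw [dotProduct_mulVec, ← mulVec_transpose, hT, hrow, smul_dotProduct, smul_eq_mul]
    have h2 : (1 : V → ℝ) ⬝ᵥ 1 = Fintype.card V := by simp [dotProduct]
    have h3 : f ⬝ᵥ 1 = 1 ⬝ᵥ f := dotProduct_comm _ _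
    simp only [mulVec_add, mulVec_smul, hrow, dotProduct_add, add_dotProduct, dotProduct_smul,
      smul_dotProduct, smul_eq_mul, h1, h2, h3]
    set n : ℝ := (Fintype.card V : ℝ)
    set s := (1 : V → ℝ) ⬝ᵥ f
    set F := f ⬝ᵥ f
    set E := f ⬝ᵥ A *ᵥ f
    -- Completing the square, `n * ‖a • 1 + b • f‖²` equals `(n * a + b * s)² + b² * (n * F - s²)`;
    -- the first term is only helpful and the second is controlled by `h`.
    refine le_of_mul_le_mul_left ?_ hn
    have h4 := mul_le_mul_of_nonneg_left h (sq_nonneg b)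
    have h5 := mul_nonneg hμ (sq_nonneg (n * a + b * s))
    linarith

namespace IsRegularMultiplicity

variable {a : V → V → ℕ} {d : ℕ}

/-- The second eigenvalue of a disconnected `d`-regular multigraph is at least `d`. -/
lemma le_of_no_crossing (ha : IsRegularMultiplicity a d) (S : Finset V) {p q : V} (hp : p ∈ S)
    (hq : q ∉ S) (hS : ∀ x ∈ S, ∀ y ∉ S, a x y = 0) :
    (d : ℝ) ≤ secondLargestEigenvalue (multiplicityMatrix a) := by
  set s : V → ℝ := fun x => if x ∈ S then 1 else 0 with hs
  have hAs : multiplicityMatrix a *ᵥ s = (d : ℝ) • s := by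
    ext x
    simp only [multiplicityMatrix, mulVec, dotProduct, of_apply, hs, mul_ite, mul_one, mul_zero,
      Pi.smul_apply, smul_eq_mul]
    rw [← ha.row x]
    split_ifs with hx
    · push_cast
      refine Finset.sum_congr rfl fun y _ => ?_
      split_ifs with hy
      · rfl
      · rw [hS x hx y hy, Nat.cast_zero]
    · refine Finset.sum_eq_zero fun y _ => ?_
      split_ifs with hy
      · rw [ha.symm, hS y hy x hx, Nat.cast_zero]
      · rfl
  have := sub_le_secondLargestEigenvalue ha.isHermitian ha.mulVec_one s (p := p) (q := q)
    (by simp [hs, hp, hq]) le_rfl (by rw [hAs, dotProduct_smul, smul_eq_mul]; simp)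
  simpa using this

/-- A `1`-regular multigraph on more than two vertices is disconnected. -/
lemma one_le_of_one_regular (ha : IsRegularMultiplicity a 1) (hV : 2 < Fintype.card V) :
    1 ≤ secondLargestEigenvalue (multiplicityMatrix a) := by
  obtain ⟨x⟩ : Nonempty V := Fintype.card_pos_iff.1 (by omega)
  obtain ⟨y, -, hy⟩ : ∃ y ∈ Finset.univ, a x y ≠ 0 :=
    Finset.exists_ne_zero_of_sum_ne_zero (by rw [ha.row]; norm_num)
  have huniq : ∀ p q r, a p q ≠ 0 → r ≠ q → a p r = 0 := fun p q r hq hr => by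
    have h1 := ha.row p
    have h2 := Finset.sum_le_sum_of_subset (f := a p) (Finset.subset_univ {q, r})
    rw [Finset.sum_pair hr.symm] at h2
    omega
  obtain ⟨q, hq⟩ : ∃ q, q ∉ ({x, y} : Finset V) := by
    by_contra! h
    have := Finset.card_le_card (fun z _ => h z : Finset.univ ⊆ ({x, y} : Finset V))
    have := Finset.card_le_two (a := x) (b := y)
    rw [Finset.card_univ] at *
    omega
  have := ha.le_of_no_crossing {x, y} (p := x) (q := q) (by simp) hq fun p hp r hr => by
    simp only [Finset.mem_insert, Finset.mem_singleton, not_or] at hp hr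
    rcases hp with rfl | rfl
    · exact huniq _ _ _ hy hr.2
    · exact huniq _ _ _ (by rwa [ha.symm]) hr.1
  simpa using this

end IsRegularMultiplicity

/-- Exactly one edge joins `S` to its complement; its ends are `u ∈ S` and `v ∉ S`. -/
structure IsBridgeCut (a : V → V → ℕ) (S : Finset V) (u v : V) : Prop where
  left_mem : u ∈ S
  right_notMem : v ∉ S
  eq : ∀ x ∈ S, ∀ y ∉ S, a x y = if x = u ∧ y = v then 1 else 0

/-! ### The lower bound for the second eigenvalue in the presence of a bridge. -/

namespace IsBridgeCut

variable {a : V → V → ℕ} {d : ℕ} {S : Finset V} {u v : V}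

lemma compl (h : IsBridgeCut a S u v) (ha : IsRegularMultiplicity a d) :
    IsBridgeCut a Sᶜ v u where
  left_mem := by simpa using h.right_notMem
  right_notMem := by simpa using h.left_mem
  eq x hx y hy := by
    rw [ha.symm, h.eq y (by simpa using hy) x (by simpa using hx)]
    simp only [and_comm]

lemma sum_add (h : IsBridgeCut a S u v) (ha : IsRegularMultiplicity a d) {x : V} (hx : x ∈ S) :
    ∑ y ∈ S, a x y + (if x = u then 1 else 0) = d := by
  rw [← ha.row x, ← Finset.sum_add_sum_compl S]
  congr 1
  rw [Finset.sum_congr rfl fun y hy => h.eq x hx y (by simpa using hy)]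
  by_cases hxu : x = u
  · simp [hxu, h.right_notMem]
  · simp [hxu]

/-- Handshake count: the degrees in `S` sum to twice the number of inner edges plus one for the
bridge. -/
lemma odd_card_mul (h : IsBridgeCut a S u v) (ha : IsRegularMultiplicity a d) :
    Odd (S.card * d) := by
  have heven : Even (∑ x ∈ S, ∑ y ∈ S, a x y) := by
    rw [← ZMod.natCast_eq_zero_iff_even, ← Finset.sum_product']
    push_cast
    refine Finset.sum_involution (fun p _ => p.swap) (fun p _ => ?_) (fun p _ hp => ?_)
      (fun p hp => by simpa [and_comm] using hp) (fun p _ => by simp)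
    · rw [Prod.fst_swap, Prod.snd_swap, ha.symm p.2 p.1]
      exact CharTwo.add_self_eq_zero _
    · intro h0
      have : p.2 = p.1 := congrArg Prod.fst h0
      simp [this, ha.diag] at hp
  have hsum : ∑ x ∈ S, ∑ y ∈ S, a x y + 1 = S.card * d := by
    have h1 : ∑ x ∈ S, (∑ y ∈ S, a x y + if x = u then 1 else 0) = ∑ x ∈ S, d :=
      Finset.sum_congr rfl fun x hx => h.sum_add ha hx
    rw [Finset.sum_add_distrib] at h1
    simpa [h.left_mem] using h1
  exact hsum ▸ heven.add_one

/-- `S` has odd size, and a single vertex without loops would have only the bridge, hence degree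
one. -/
lemma three_le_card (h : IsBridgeCut a S u v) (ha : IsRegularMultiplicity a d) (hd : 2 ≤ d) :
    3 ≤ S.card := by
  have hcard : Odd S.card := (Nat.odd_mul.1 (h.odd_card_mul ha)).1
  have hne : S.card ≠ 1 := fun h1 => by
    obtain ⟨x, rfl⟩ := Finset.card_eq_one.1 h1
    have := h.left_mem
    have h2 := h.sum_add ha h.left_mem
    obtain rfl : u = x := by simpa using this
    simp [ha.diag] at h2
    omega
  obtain ⟨k, hk⟩ := hcard
  omega

/-- The quadratic form of a function that is constant on `S \ {u}` and on `Sᶜ \ {v}`. -/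
lemma quadratic_form (h : IsBridgeCut a S u v) (ha : IsRegularMultiplicity a d)
    (x₁ x₂ x₃ x₄ : ℝ) :
    let f : V → ℝ := fun x =>
      if x ∈ S then (if x = u then x₂ else x₁) else (if x = v then x₃ else x₄)
    (1 ⬝ᵥ f = (S.card - 1) * x₁ + x₂ + x₃ + (Fintype.card V - S.card - 1) * x₄) ∧
    (f ⬝ᵥ f = (S.card - 1) * x₁ ^ 2 + x₂ ^ 2 + x₃ ^ 2 + (Fintype.card V - S.card - 1) * x₄ ^ 2) ∧
    d * (f ⬝ᵥ f) - f ⬝ᵥ multiplicityMatrix a *ᵥ f =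
      (d - 1) * (x₁ - x₂) ^ 2 + (x₂ - x₃) ^ 2 + (d - 1) * (x₃ - x₄) ^ 2 := by
  intro f
  set A := multiplicityMatrix a with hA
  set s : V → ℝ := fun x => if x ∈ S then 1 else 0 with hs
  set U : V → ℝ := Pi.single u 1 with hU
  set W : V → ℝ := Pi.single v 1 with hW
  have hu := h.left_mem
  have hv := h.right_notMem
  have huv : u ≠ v := fun h0 => hv (h0 ▸ hu)
  have hf : f = x₄ • 1 + (x₁ - x₄) • s + (x₂ - x₁) • U + (x₃ - x₄) • W := by
    ext x
    simp only [f, hs, hU, hW, Pi.add_apply, Pi.smul_apply, Pi.one_apply, smul_eq_mul,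
      Pi.single_apply]
    by_cases hx : x ∈ S
    · have : x ≠ v := fun h0 => hv (h0 ▸ hx)
      by_cases hxu : x = u <;> simp [*]
    · have : x ≠ u := fun h0 => hx (h0 ▸ hu)
      by_cases hxv : x = v <;> simp [*, huv.symm]
  -- Only the bridge leaves `S`: `u` loses one neighbour in `S` and `v` gains one. This makes the
  -- form independent of the edges inside the two sides.
  have hAs : A *ᵥ s = (d : ℝ) • s - U + W := by
    ext x
    have hrow : (A *ᵥ s) x = ((∑ y ∈ S, a x y : ℕ) : ℝ) := by
      simp [hA, multiplicityMatrix, mulVec, dotProduct, hs]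
    rw [hrow]
    simp only [hs, hU, hW, Pi.add_apply, Pi.sub_apply, Pi.smul_apply, smul_eq_mul,
      Pi.single_apply]
    by_cases hx : x ∈ S
    · have hxv : x ≠ v := fun h0 => hv (h0 ▸ hx)
      rw [← h.sum_add ha hx]
      push_cast
      simp [hx, hxv]
    · have hxu : x ≠ u := fun h0 => hx (h0 ▸ hu)
      have h1 : ∑ y ∈ S, a x y = if x = v then 1 else 0 := by
        rw [Finset.sum_congr rfl fun y hy => (ha.symm x y).trans (h.eq y hy x hx)]
        by_cases hxv : x = v
        · simp [hxv, hu]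
        · simp [hxv]
      rw [h1]
      simp [hx, hxu]
  have hT : Aᵀ = A := by rw [← conjTranspose_eq_transpose_of_trivial]; exact ha.isHermitian
  have hsym : ∀ f g : V → ℝ, f ⬝ᵥ A *ᵥ g = g ⬝ᵥ A *ᵥ f := fun f g => by
    rw [dotProduct_mulVec, ← mulVec_transpose, hT, dotProduct_comm]
  have hone : A *ᵥ 1 = (d : ℝ) • 1 := ha.mulVec_one
  have e1 : (1 : V → ℝ) ⬝ᵥ 1 = Fintype.card V := by simp [dotProduct]
  have e2 : (1 : V → ℝ) ⬝ᵥ s = S.card := by simp [dotProduct, hs]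
  have e3 : s ⬝ᵥ s = S.card := by simp [dotProduct, hs]
  have e4 : s ⬝ᵥ 1 = S.card := by simp [dotProduct, hs]
  have b1 : U ⬝ᵥ A *ᵥ U = 0 := by simp [hU, hA, multiplicityMatrix, ha.diag]
  have b2 : W ⬝ᵥ A *ᵥ W = 0 := by simp [hW, hA, multiplicityMatrix, ha.diag]
  have b3 : U ⬝ᵥ A *ᵥ W = 1 := by
    simp [hW, hU, hA, multiplicityMatrix, h.eq u hu v hv]
  have b4 : W ⬝ᵥ A *ᵥ U = 1 := by rw [hsym, b3]
  have b5 : ∀ g, s ⬝ᵥ A *ᵥ g = g ⬝ᵥ ((d : ℝ) • s - U + W) := fun g => by rw [hsym, hAs]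
  have b6 : ∀ g, 1 ⬝ᵥ A *ᵥ g = g ⬝ᵥ ((d : ℝ) • 1) := fun g => by rw [hsym, hone]
  have c1 : ∀ g, U ⬝ᵥ g = g u := fun g => by simp [hU]
  have c2 : ∀ g, W ⬝ᵥ g = g v := fun g => by simp [hW]
  have c3 : ∀ g, g ⬝ᵥ U = g u := fun g => by simp [hU]
  have c4 : ∀ g, g ⬝ᵥ W = g v := fun g => by simp [hW]
  have s1 : s u = 1 := by simp [hs, hu]
  have s2 : s v = 0 := by simp [hs, hv]
  have u1 : U u = 1 := by simp [hU]
  have u2 : U v = 0 := by simp [hU, huv.symm]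
  have w1 : W u = 0 := by simp [hW, huv]
  have w2 : W v = 1 := by simp [hW]
  clear_value s U W A f
  subst hf
  simp only [mulVec_add, mulVec_smul, dotProduct_add, add_dotProduct, dotProduct_smul,
    smul_dotProduct, smul_eq_mul, b1, b2, b3, b4, b5, b6, hone, hAs, dotProduct_sub, e1, e2, e3, e4]
  simp only [c1, c2, c3, c4, s1, s2, u1, u2, w1, w2, Pi.one_apply]
  refine ⟨?_, ?_, ?_⟩ <;> ring

/-- The test vector for a bridge cut whose smaller side has `t + 3` vertices, where the total
number of vertices is `m + 4`. -/
lemma exists_test_vector {m e μ t : ℝ} (hm : 2 ≤ m) (he : 2 ≤ e) (hμ : 0 ≤ μ) (hμ' : μ ≤ 2 / 3)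
    (hg : gapCubic m e μ = 0) (ht : 0 ≤ t) (htm : 2 * t ≤ m - 2) :
    ∃ x₁ x₂ x₃ x₄ : ℝ, x₁ ≠ x₂ ∧
      (m + 4) * (e * (x₁ - x₂) ^ 2 + (x₂ - x₃) ^ 2 + e * (x₃ - x₄) ^ 2) ≤
        μ * ((m + 4) * ((t + 2) * x₁ ^ 2 + x₂ ^ 2 + x₃ ^ 2 + (m - t) * x₄ ^ 2)
          - ((t + 2) * x₁ + x₂ + x₃ + (m - t) * x₄) ^ 2) := by
  have hμ0 : μ ≠ 0 := by
    rintro rfl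
    have : 0 < (m + 4) * e ^ 2 := by positivity
    simp only [gapCubic] at hg
    linarith
  have hp : 0 < (m + 1) * e - m * μ := by nlinarith
  have hq : 0 < 3 * e - 2 * μ := by linarith
  -- Up to scaling this is the eigenvector of `Q` for `d - μ`. The first and last rows of the
  -- eigenvector equation (`r1`, `r4`) and orthogonality to the class sizes `2, 1, 1, m` (`hsum`)
  -- hold identically in `μ`; the second row (`r2`) is the cubic equation.
  obtain ⟨x₁, h1⟩ : ∃ x, x = e * ((m + 1) * e - m * μ) := ⟨_, rfl⟩
  obtain ⟨x₂, h2⟩ : ∃ x, x = (e - 2 * μ) * ((m + 1) * e - m * μ) := ⟨_, rfl⟩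
  obtain ⟨x₃, h3⟩ : ∃ x, x = -((e - m * μ) * (3 * e - 2 * μ)) := ⟨_, rfl⟩
  obtain ⟨x₄, h4⟩ : ∃ x, x = -(e * (3 * e - 2 * μ)) := ⟨_, rfl⟩
  have r1 : e * (x₁ - x₂) = 2 * μ * x₁ := by rw [h1, h2]; ring
  have r2 : x₂ - x₃ = μ * x₂ + 2 * μ * x₁ := by
    rw [h1, h2, h3]
    rw [gapCubic] at hg
    linear_combination -hg
  have r4 : e * (x₄ - x₃) = μ * m * x₄ := by rw [h4, h3]; ring
  have hsum : 2 * x₁ + x₂ + x₃ + m * x₄ = 0 := by rw [h1, h2, h3, h4]; ring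
  have hE : e * (x₁ - x₂) ^ 2 + (x₂ - x₃) ^ 2 + e * (x₃ - x₄) ^ 2 =
      μ * (2 * x₁ ^ 2 + x₂ ^ 2 + x₃ ^ 2 + m * x₄ ^ 2) := by
    linear_combination (x₁ - x₂) * r1 + (x₂ - x₃) * r2 + (x₄ - x₃) * r4 - μ * x₃ * hsum
  have hx14 : 0 ≤ x₁ - x₄ := by
    rw [h1, h4]
    nlinarith [mul_pos (by linarith : 0 < e) hp, mul_pos (by linarith : 0 < e) hq]
  -- Moving `t` vertices from the value `x₄` to `x₁` changes the variance term by `t * (x₁ - x₄)`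
  -- times this quantity, which does not increase with `t`; so the extreme case `2 * t = m - 2`
  -- suffices.
  have hx : 0 ≤ (m + 4) * (x₁ + x₄) - t * (x₁ - x₄) := by
    have h5 : 2 * ((m + 4) * (x₁ + x₄)) - (m - 2) * (x₁ - x₄) =
        e * ((m - 2) * ((m + 4) * e - (m + 6) * μ)) := by
      rw [h1, h4]; ring
    have h6 : 0 ≤ e * ((m - 2) * ((m + 4) * e - (m + 6) * μ)) :=
      mul_nonneg (by linarith) (mul_nonneg (by linarith) (by nlinarith))
    have h7 := mul_le_mul_of_nonneg_right htm hx14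
    linarith
  refine ⟨x₁, x₂, x₃, x₄, fun h => ?_, ?_⟩
  · rw [h, sub_self, mul_zero] at r1
    have hx2 : x₂ = 0 := by
      rcases mul_eq_zero.1 r1.symm with h' | h'
      · exact absurd (by linarith) hμ0
      · exact h'
    have : 0 < x₁ := h1 ▸ mul_pos (by linarith) hp
    linarith
  · rw [hE]
    have h5 := mul_nonneg hμ (mul_nonneg (mul_nonneg ht hx14) hx)
    have h6 : (t + 2) * x₁ + x₂ + x₃ + (m - t) * x₄ = t * (x₁ - x₄) := by
      linear_combination hsum
    rw [h6]
    linarith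

lemma rho_le_of_two_mul_card_le (h : IsBridgeCut a S u v) (ha : IsRegularMultiplicity a d) {n : ℕ} (hd : 2 ≤ d)
    (hn : Fintype.card V = n) (hS : 2 * S.card ≤ n) :
    rho d n ≤ secondLargestEigenvalue (multiplicityMatrix a) := by
  have h1 := h.three_le_card ha hd
  have h2 := (h.compl ha).three_le_card ha hd
  rw [Finset.card_compl, hn] at h2
  have hd3 : 3 ≤ d := by
    obtain ⟨k, hk⟩ := (Nat.odd_mul.1 (h.odd_card_mul ha)).2
    omega
  have hn6 : (6 : ℝ) ≤ n := by exact_mod_cast (by omega : 6 ≤ n)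
  have hS3 : (3 : ℝ) ≤ S.card := by exact_mod_cast h1
  have hSn : 2 * (S.card : ℝ) ≤ n := by exact_mod_cast hS
  have hd' : (3 : ℝ) ≤ d := by exact_mod_cast hd3
  have hlt := lt_rho (by omega : 1 ≤ d) (by omega : 5 ≤ n)
  have hle := rho_le (by omega : 1 ≤ d) (by omega : 5 ≤ n)
  -- Both sides have at least three vertices, so `n ≥ 6` and the bound `lt_rho` yields `d - ρ <
  -- 2/3`.
  have hfrac : 1 / ((n : ℝ) - 3) ≤ 1 / 3 := by
    apply one_div_le_one_div_of_le <;> linarith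
  obtain ⟨x₁, x₂, x₃, x₄, hne, hx⟩ := exists_test_vector (m := (n : ℝ) - 4) (e := (d : ℝ) - 1)
    (μ := d - rho d n) (t := S.card - 3) (by linarith) (by linarith) (by linarith) (by linarith)
    (rho_spec (by omega) (by omega)).1 (by linarith) (by linarith)
  obtain ⟨q1, q2, q3⟩ := h.quadratic_form ha x₁ x₂ x₃ x₄
  obtain ⟨p, hp, hpu⟩ := Finset.exists_mem_ne (by omega : 1 < S.card) u
  have := sub_le_secondLargestEigenvalue ha.isHermitian ha.mulVec_one
    (fun x => if x ∈ S then (if x = u then x₂ else x₁) else (if x = v then x₃ else x₄))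
    (p := p) (q := u) (by simpa [hp, hpu, h.left_mem] using hne) (sub_nonneg.2 hle)
    (by rw [q3, q2, q1, hn]; convert hx using 1 <;> ring)
  linarith

/-- The second eigenvalue of a `d`-regular multigraph with a bridge is at least `ρ(d, n)`. -/
lemma rho_le_secondLargestEigenvalue (h : IsBridgeCut a S u v) (ha : IsRegularMultiplicity a d) {n : ℕ} (hd : 2 ≤ d)
    (hn : Fintype.card V = n) : rho d n ≤ secondLargestEigenvalue (multiplicityMatrix a) := by
  rcases le_total (2 * S.card) n with hS | hS
  · exact h.rho_le_of_two_mul_card_le ha hd hn hS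
  · refine (h.compl ha).rho_le_of_two_mul_card_le ha hd hn ?_
    rw [Finset.card_compl, hn]
    omega

end IsBridgeCut

end RegularMatrix

/-! ### The upper bound on six vertices. -/

section SixVertices

/-- On six vertices, `d - A` is at least `μ` on the vectors of coordinate sum `0`. -/
lemma six_vertex_form_le {e μ : ℝ} (he : 2 ≤ e) (hμ' : μ ≤ 2 / 3)
    (hg : 2 * μ ^ 2 - (3 * e + 4) * μ + 2 * e = 0) (u p q v r s : ℝ)
    (hsum : u + p + q + (v + r + s) = 0) :
    e * (u * p + u * q + v * r + v * s) + (e + 2) * (p * q + r * s) + 2 * (u * v) ≤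
      (e + 1 - μ) * (u ^ 2 + p ^ 2 + q ^ 2 + (v ^ 2 + r ^ 2 + s ^ 2)) := by
  -- `α` and `γ` describe the part that is odd under swapping the two triangles and constant on `{p,
  -- q}` and on `{r, s}`. The hypothesis `hg` says that its `2 × 2` form is singular, hence a
  -- multiple of a square. The remaining parts, the even one (`h2`) and the differences `p - q`, `r
  -- - s` (`h3`), belong to the larger eigenvalues `3e/2` and `(3e + 4)/2`.
  set α := (u - v) / 2 with hα
  set γ := (p + q - r - s) / 4 with hγ
  have h1 : 0 ≤ (e + 2 - μ) * α ^ 2 - 2 * e * (α * γ) + (e - 2 * μ) * γ ^ 2 := by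
    refine (mul_nonneg_iff_of_pos_left (by linarith : 0 < e + 2 - μ)).1 ?_
    have : (e + 2 - μ) * ((e + 2 - μ) * α ^ 2 - 2 * e * (α * γ) + (e - 2 * μ) * γ ^ 2) =
        ((e + 2 - μ) * α - e * γ) ^ 2 := by
      linear_combination γ ^ 2 * hg
    rw [this]
    positivity
  have h2 : 0 ≤ (3 * e / 2 - μ) * (u + v) ^ 2 := mul_nonneg (by linarith) (sq_nonneg _)
  have h3 : 0 ≤ (3 * e + 4 - 2 * μ) * ((p - q) ^ 2 + (r - s) ^ 2) :=
    mul_nonneg (by linarith) (by positivity)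
  have hs : s = -(u + p + q + v + r) := by linarith
  rw [hα, hγ, hs] at h1
  rw [hs] at h3 ⊢
  linarith

lemma Finset.exists_eq_triple {V : Type*} [DecidableEq V] {S : Finset V} {u : V} (hu : u ∈ S)
    (hS : S.card = 3) : ∃ p q, u ≠ p ∧ u ≠ q ∧ p ≠ q ∧ S = {u, p, q} := by
  obtain ⟨p, q, hpq, h⟩ := Finset.card_eq_two.1 (by rw [Finset.card_erase_of_mem hu, hS] :
    (S.erase u).card = 2)
  have h' : S = {u, p, q} := by rw [← h, Finset.insert_erase hu]
  have hu' : u ∉ ({p, q} : Finset V) := h ▸ Finset.notMem_erase u S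
  simp only [Finset.mem_insert, Finset.mem_singleton, not_or] at hu'
  exact ⟨p, q, hu'.1, hu'.2, hpq, h'⟩

variable {V : Type*} [Fintype V] [DecidableEq V] {a : V → V → ℕ} {d : ℕ} {S : Finset V} {u v : V}

/-- The three degree equations determine the three multiplicities of the triangle. -/
lemma IsBridgeCut.triple_multiplicities (h : IsBridgeCut a S u v)
    (ha : IsRegularMultiplicity a d) {p q : V} (hup : u ≠ p) (huq : u ≠ q) (hpq : p ≠ q)
    (hS : S = {u, p, q}) :
    2 * a u p + 1 = d ∧ 2 * a u q + 1 = d ∧ 2 * a p q = d + 1 := by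
  have h1 := h.sum_add ha (x := u) (by simp [hS])
  have h2 := h.sum_add ha (x := p) (by simp [hS])
  have h3 := h.sum_add ha (x := q) (by simp [hS])
  have hu : u ∉ ({p, q} : Finset V) := by simp [hup, huq]
  rw [hS, Finset.sum_insert hu, Finset.sum_pair hpq, ha.diag] at h1 h2 h3
  simp only [if_true, if_neg hup.symm, if_neg huq.symm] at h1 h2 h3
  rw [ha.symm p u] at h2
  rw [ha.symm q u, ha.symm q p] at h3
  omega

/-- A six-vertex `d`-regular multigraph with a bridge has second eigenvalue at most `ρ(d, 6)`. -/
lemma IsBridgeCut.secondLargestEigenvalue_le_rho (h : IsBridgeCut a S u v)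
    (ha : IsRegularMultiplicity a d) (hd : 3 ≤ d) (hV : Fintype.card V = 6) :
    secondLargestEigenvalue (multiplicityMatrix a) ≤ rho d 6 := by
  have h1 := h.three_le_card ha (by omega)
  have h2 := (h.compl ha).three_le_card ha (by omega)
  rw [Finset.card_compl, hV] at h2
  have hS3 : S.card = 3 := by omega
  obtain ⟨p, q, hup, huq, hpq, hS⟩ := Finset.exists_eq_triple h.left_mem hS3
  obtain ⟨r, s, hvr, hvs, hrs, hSc⟩ := Finset.exists_eq_triple (h.compl ha).left_mem
    (by rw [Finset.card_compl, hV, hS3] : Sᶜ.card = 3)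
  obtain ⟨m1, m2, m3⟩ := h.triple_multiplicities ha hup huq hpq hS
  obtain ⟨m4, m5, m6⟩ := (h.compl ha).triple_multiplicities ha hvr hvs hrs hSc
  have hsum : ∀ f : V → ℝ, ∑ x, f x = f u + f p + f q + (f v + f r + f s) := fun f => by
    have hu : u ∉ ({p, q} : Finset V) := by simp [hup, huq]
    have hv : v ∉ ({r, s} : Finset V) := by simp [hvr, hvs]
    rw [← Finset.sum_add_sum_compl S, hSc, hS, Finset.sum_insert hu, Finset.sum_pair hpq,
      Finset.sum_insert hv, Finset.sum_pair hrs]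
    ring
  have hcross : ∀ x ∈ S, ∀ y ∈ Sᶜ, (a x y : ℝ) = (if x = u ∧ y = v then 1 else 0) ∧
      (a y x : ℝ) = (if x = u ∧ y = v then 1 else 0) := fun x hx y hy => by
    rw [ha.symm y x, h.eq x hx y (by simpa using hy)]
    simp
  rw [hSc, hS] at hcross
  simp only [Finset.mem_insert, Finset.mem_singleton, forall_eq_or_imp, forall_eq,
    hup.symm, huq.symm, hvr.symm, hvs.symm, and_true, and_false, if_true, if_false] at hcross
  obtain ⟨⟨⟨c1, c1'⟩, ⟨c2, c2'⟩, ⟨c3, c3'⟩⟩, ⟨⟨c4, c4'⟩, ⟨c5, c5'⟩, ⟨c6, c6'⟩⟩,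
    ⟨⟨c7, c7'⟩, ⟨c8, c8'⟩, ⟨c9, c9'⟩⟩⟩ := hcross
  have hlt := lt_rho (by omega : 1 ≤ d) (by norm_num : 5 ≤ 6)
  norm_num at hlt
  have hd' : (3 : ℝ) ≤ d := by exact_mod_cast hd
  refine secondLargestEigenvalue_le ha.isHermitian (by omega) 1 fun z hz => ?_
  have hz' : z u + z p + z q + (z v + z r + z s) = 0 := by rw [← hsum, ← hz]; simp [dotProduct]
  have key := six_vertex_form_le (e := d - 1) (by linarith) (by linarith) (rho_six_quadratic hd)
    (z u) (z p) (z q) (z v) (z r) (z s) hz'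
  have k1 : 2 * (a u p : ℝ) + 1 = d := by exact_mod_cast m1
  have k2 : 2 * (a u q : ℝ) + 1 = d := by exact_mod_cast m2
  have k3 : 2 * (a p q : ℝ) = d + 1 := by exact_mod_cast m3
  have k4 : 2 * (a v r : ℝ) + 1 = d := by exact_mod_cast m4
  have k5 : 2 * (a v s : ℝ) + 1 = d := by exact_mod_cast m5
  have k6 : 2 * (a r s : ℝ) = d + 1 := by exact_mod_cast m6
  simp only [dotProduct, mulVec, multiplicityMatrix, of_apply, hsum, ha.diag, c1, c1', c2, c2', c3,
    c3', c4, c4', c5, c5', c6, c6', c7, c7', c8, c8', c9, c9', ha.symm p u, ha.symm q u,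
    ha.symm q p, ha.symm r v, ha.symm s v, ha.symm s r, Nat.cast_zero]
  refine le_of_eq_of_le ?_ (key.trans_eq ?_)
  · linear_combination z u * z p * k1 + z u * z q * k2 + z p * z q * k3 + z v * z r * k4
      + z v * z s * k5 + z r * z s * k6
  · ring

end SixVertices

/-! ### From multigraphs and edge cuts to multiplicity matrices. -/

namespace Graph

variable {α β : Type*} {G : Graph α β}

/-- The number of edges between two vertices. -/
def multiplicity (G : Graph α β) (x y : G.vertexSet) : ℕ := {e | G.IsLink e x y}.ncard

lemma lambda2_eq [Fintype G.vertexSet] [DecidableEq G.vertexSet] :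
    G.lambda2 = secondLargestEigenvalue (multiplicityMatrix G.multiplicity) := by
  rw [lambda2]
  congr!

lemma IsDRegular.isRegularMultiplicity [Fintype G.vertexSet] [G.Loopless] {d : ℕ}
    (h : G.IsDRegular d) : IsRegularMultiplicity G.multiplicity d where
  symm x y := by simp only [multiplicity, isLink_comm]
  diag x := by simp [multiplicity, isLink_self_iff]
  row x := by
    have hU : G.incidenceSet x = ⋃ y : G.vertexSet, {e | G.IsLink e x y} := by
      ext e
      simp only [mem_incidenceSet, Inc, Set.mem_iUnion, Set.mem_ofPred_eq, Subtype.exists,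
        exists_prop]
      exact exists_congr fun y => ⟨fun h => ⟨h.right_mem, h⟩, fun h => h.2⟩
    have hfin : (G.incidenceSet x).Finite := Set.finite_of_encard_eq_coe (h x x.2)
    have hd : (G.incidenceSet x).ncard = d := by rw [Set.ncard, h x x.2, ENat.toNat_natCast]
    rw [← hd, hU, Set.ncard_iUnion_of_finite
      (s := fun y : G.vertexSet => {e | G.IsLink e x y})
      (fun y => hfin.subset fun e he => IsLink.inc_left he) fun y z hyz => ?_,
      finsum_eq_sum_of_fintype]
    · rfl
    · refine Set.disjoint_left.2 fun e hy hz => hyz (Subtype.ext ?_)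
      exact IsLink.right_unique hy hz

/-- Every edge of `G` between `S` and its complement is in `F`. -/
def IsCrossingSubset (G : Graph α β) (S : Set G.vertexSet) (F : Set β) : Prop :=
  ∀ x ∈ S, ∀ y ∉ S, ∀ e, G.IsLink e x y → e ∈ F

/-- `S` is the component of some vertex `p` in `G - F`, where `q` is a vertex that `p` does not
reach. -/
lemma IsDisconnecting.exists_isCrossingSubset [Nonempty G.vertexSet] {F : Set β}
    (h : G.IsDisconnecting F) :
    ∃ S : Set G.vertexSet, (∃ p, p ∈ S) ∧ (∃ q, q ∉ S) ∧ G.IsCrossingSubset S F := by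
  let H : SimpleGraph G.vertexSet := (G.deleteEdges F).toSimpleGraph
  have hH : ¬ H.Connected := h.2
  have hpre : ¬ H.Preconnected := fun h0 => hH ⟨h0⟩
  simp only [SimpleGraph.Preconnected, not_forall] at hpre
  obtain ⟨p, q, hpq⟩ := hpre
  refine ⟨{x | H.Reachable p x}, ⟨p, SimpleGraph.Reachable.refl p⟩, ⟨q, hpq⟩,
    fun x hx y hy e he => ?_⟩
  by_contra heF
  have hadj : H.Adj x y := by
    refine ⟨fun hxy => hy (hxy ▸ hx), e, ?_⟩
    rw [deleteEdges_isLink]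
    exact ⟨he, heF⟩
  exact hy (SimpleGraph.Reachable.trans hx hadj.reachable)

lemma IsCrossingSubset.isDisconnecting {S : Set G.vertexSet} {F : Set β}
    (h : G.IsCrossingSubset S F) (hF : F ⊆ G.edgeSet) {p q : G.vertexSet} (hp : p ∈ S)
    (hq : q ∉ S) : G.IsDisconnecting F := by
  refine ⟨hF, fun hconn => hq ?_⟩
  let H : SimpleGraph G.vertexSet := (G.deleteEdges F).toSimpleGraph
  have hreach : H.Reachable p q := hconn.preconnected p q
  rw [SimpleGraph.reachable_iff_reflTransGen] at hreach
  clear hq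
  induction hreach with
  | refl => exact hp
  | @tail x y _ hxy hx =>
    by_contra hy
    obtain ⟨-, e, he⟩ := hxy
    rw [deleteEdges_isLink] at he
    exact he.2 (h x hx y hy e he.1)

lemma IsCrossingSubset.empty_or_isBridgeCut [Fintype G.vertexSet] [DecidableEq G.vertexSet]
    {S : Finset G.vertexSet} {F : Set β} (h : G.IsCrossingSubset S F) (hF : F.Subsingleton) :
    G.IsCrossingSubset S ∅ ∨ ∃ u v, IsBridgeCut G.multiplicity S u v := by
  refine or_iff_not_imp_left.2 fun hne => ?_
  simp only [IsCrossingSubset, not_forall] at hne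
  obtain ⟨u, hu, v, hv, e, he, -⟩ := hne
  simp only [Finset.mem_coe] at hu hv
  refine ⟨u, v, hu, hv, fun x hx y hy => ?_⟩
  have heq : ∀ f, G.IsLink f x y → f = e := fun f hf => hF (h x hx y hy f hf) (h u hu v hv e he)
  split_ifs with hxy
  · obtain ⟨rfl, rfl⟩ := hxy
    rw [multiplicity, Set.ncard_eq_one]
    exact ⟨e, Set.eq_singleton_iff_unique_mem.2 ⟨he, heq⟩⟩
  · have : {f | G.IsLink f x y} = ∅ := by
      refine Set.eq_empty_of_forall_notMem fun f hf => hxy ?_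
      have hf' : G.IsLink e x y := heq f hf ▸ hf
      rcases hf'.eq_and_eq_or_eq_and_eq he with ⟨h1, h2⟩ | ⟨h1, -⟩
      · exact ⟨Subtype.ext h1, Subtype.ext h2⟩
      · exact absurd (Subtype.ext h1 ▸ hx) hv
    rw [multiplicity, this, Set.ncard_empty]

lemma IsCrossingSubset.multiplicity_eq_zero {S : Set G.vertexSet} (h : G.IsCrossingSubset S ∅) :
    ∀ x ∈ S, ∀ y ∉ S, G.multiplicity x y = 0 := fun x hx y hy => by
  have : {e | G.IsLink e x y} = ∅ := Set.eq_empty_of_forall_notMem fun e he => h x hx y hy e he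
  rw [multiplicity, this, Set.ncard_empty]

lemma exists_isDisconnecting_of_edgeConnectivity_lt {k : ℕ∞} (h : G.edgeConnectivity < k) :
    ∃ F, G.IsDisconnecting F ∧ F.encard < k := by
  obtain ⟨_, ⟨F, hF, rfl⟩, hk⟩ := sInf_lt_iff.1 h
  exact ⟨F, hF, hk⟩

lemma IsDisconnecting.edgeConnectivity_le {F : Set β} (h : G.IsDisconnecting F) :
    G.edgeConnectivity ≤ F.encard := sInf_le ⟨F, h, rfl⟩

lemma subsingleton_of_encard_lt_two {F : Set β} (h : F.encard < 2) : F.Subsingleton := by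
  rw [← Set.encard_le_one_iff_subsingleton]
  exact Order.le_of_lt_succ h

/-- A `d`-regular multigraph with edge-connectivity less than `2` has `ρ(d, n) ≤ λ₂`. -/
lemma rho_le_lambda2 [Fintype G.vertexSet] [G.Loopless] {d n : ℕ} (hd : 1 ≤ d) (hn : 5 ≤ n)
    (hcard : Fintype.card G.vertexSet = n) (hG : G.IsDRegular d) (hκ : G.edgeConnectivity < 2) :
    rho d n ≤ G.lambda2 := by
  classical
  have ha := hG.isRegularMultiplicity
  have : Nonempty G.vertexSet := Fintype.card_pos_iff.1 (by omega)
  rw [lambda2_eq]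
  -- For `d = 1` a side of a bridge cut may be a single vertex, so the test vector is unavailable;
  -- but then the multigraph is disconnected.
  rcases hd.eq_or_lt with rfl | hd2
  · exact (rho_le le_rfl hn).trans (by simpa using ha.one_le_of_one_regular (by omega))
  obtain ⟨F, hF, hF2⟩ := exists_isDisconnecting_of_edgeConnectivity_lt hκ
  obtain ⟨S, ⟨p, hp⟩, ⟨q, hq⟩, hS⟩ := hF.exists_isCrossingSubset
  rw [← S.coe_toFinset] at hS hp hq
  rcases hS.empty_or_isBridgeCut (subsingleton_of_encard_lt_two hF2) with h0 | ⟨u, v, huv⟩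
  · exact (rho_le hd hn).trans (ha.le_of_no_crossing S.toFinset hp hq h0.multiplicity_eq_zero)
  · exact huv.rho_le_secondLargestEigenvalue ha hd2 hcard

/-- A six-vertex `d`-regular multigraph with edge-connectivity `1` has `λ₂ = ρ(d, 6)`. -/
lemma lambda2_eq_rho_six [Fintype G.vertexSet] [G.Loopless] {d : ℕ} (hd : 3 ≤ d)
    (hcard : Fintype.card G.vertexSet = 6) (hG : G.IsDRegular d) (hκ : G.edgeConnectivity = 1) :
    G.lambda2 = rho d 6 := by
  have hκ2 : G.edgeConnectivity < 2 := by rw [hκ]; norm_num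
  refine le_antisymm ?_ (rho_le_lambda2 (by omega) (by norm_num) hcard hG hκ2)
  classical
  have ha := hG.isRegularMultiplicity
  have : Nonempty G.vertexSet := Fintype.card_pos_iff.1 (by omega)
  rw [lambda2_eq]
  obtain ⟨F, hF, hF2⟩ := exists_isDisconnecting_of_edgeConnectivity_lt hκ2
  obtain ⟨S, ⟨p, hp⟩, ⟨q, hq⟩, hS⟩ := hF.exists_isCrossingSubset
  rw [← S.coe_toFinset] at hS hp hq
  rcases hS.empty_or_isBridgeCut (subsingleton_of_encard_lt_two hF2) with h0 | ⟨u, v, huv⟩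
  -- Without crossing edges the empty set would disconnect `G`, against `κ' = 1`.
  · have := (h0.isDisconnecting (Set.empty_subset _) hp hq).edgeConnectivity_le
    rw [hκ, Set.encard_empty] at this
    exact absurd this (by norm_num)
  · exact huv.secondLargestEigenvalue_le_rho ha hd hcard

/-! ### Extremal multigraphs on six vertices. -/

/-- The ends of the edges in each of the seven classes of parallel edges of `twoTriangles`. -/
def twoTrianglesEnds : ℕ → Sym2 (Fin 6)
  | 0 => s(0, 1)
  | 1 => s(0, 2)
  | 2 => s(3, 4)
  | 3 => s(3, 5)
  | 4 => s(1, 2)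
  | 5 => s(4, 5)
  | _ => s(0, 3)

/-- The sizes of the seven classes of parallel edges of `twoTriangles`. -/
def twoTrianglesMult (k : ℕ) : ℕ → ℕ
  | 0 | 1 | 2 | 3 => k
  | 4 | 5 => k + 1
  | _ => 1

/-- Two triangles with multiple edges, joined by a bridge. Edge `7 * j + c` is the `j`-th edge
of class `c`. -/
def twoTriangles (k : ℕ) : Graph (Fin 6) ℕ where
  vertexSet := Set.univ
  IsLink e x y := e / 7 < twoTrianglesMult k (e % 7) ∧ twoTrianglesEnds (e % 7) = s(x, y)
  isLink_symm e _ := ⟨fun x y h => by rwa [Sym2.eq_swap]⟩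
  eq_or_eq_of_isLink_of_isLink e x y v w h₁ h₂ := by
    have h := h₁.2.symm.trans h₂.2
    rw [Sym2.eq_iff] at h
    exact h.imp And.left And.left
  left_mem_of_isLink _ _ _ _ := Set.mem_univ _

lemma twoTriangles_isLink {k e : ℕ} {x y : Fin 6} : (twoTriangles k).IsLink e x y ↔
    e / 7 < twoTrianglesMult k (e % 7) ∧ twoTrianglesEnds (e % 7) = s(x, y) := Iff.rfl

instance (k : ℕ) : (twoTriangles k).Loopless where
  not_isLoopAt e x h := by
    have h1 := (twoTriangles_isLink.1 h).2
    have h2 : ∀ c < 7, ∀ x, twoTrianglesEnds c ≠ s(x, x) := by decide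
    exact h2 _ (Nat.mod_lt _ (by norm_num)) _ h1

/-- Division by `7` identifies edges with pairs (index, class), so edges can be counted class by
class. -/
lemma encard_setOf_div_lt_mod (f : ℕ → ℕ) (P : ℕ → Prop) [DecidablePred P] :
    {e : ℕ | e / 7 < f (e % 7) ∧ P (e % 7)}.encard =
      ∑ c ∈ (Finset.range 7).filter P, f c := by
  have h : {e : ℕ | e / 7 < f (e % 7) ∧ P (e % 7)} =
      (((Finset.range 7).filter P).biUnion fun c => (Finset.range (f c)).image (7 * · + c) :
        Finset ℕ) := by
    ext e
    simp only [Set.mem_ofPred_eq, Finset.coe_biUnion, Finset.coe_image, Set.mem_iUnion,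
      Set.mem_image, Finset.mem_coe, Finset.mem_range, Finset.mem_filter, exists_prop]
    constructor
    · exact fun ⟨h1, h2⟩ =>
        ⟨e % 7, ⟨Nat.mod_lt _ (by norm_num), h2⟩, e / 7, h1, Nat.div_add_mod e 7⟩
    · rintro ⟨c, ⟨hc, hP⟩, j, hj, rfl⟩
      have h1 : (7 * j + c) / 7 = j := by omega
      have h2 : (7 * j + c) % 7 = c := by omega
      rw [h1, h2]
      exact ⟨hj, hP⟩
  rw [h, Set.encard_coe_eq_coe_finsetCard, Finset.card_biUnion]
  · congr 1
    refine Finset.sum_congr rfl fun c _ => ?_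
    rw [Finset.card_image_of_injective _ fun i j hij => by simpa using hij, Finset.card_range]
  · intro c hc c' hc' hne
    rw [Finset.mem_coe, Finset.mem_filter, Finset.mem_range] at hc hc'
    refine Finset.disjoint_left.2 fun e he he' => ?_
    obtain ⟨i, -, rfl⟩ := Finset.mem_image.1 he
    obtain ⟨j, -, hj⟩ := Finset.mem_image.1 he'
    omega

lemma twoTriangles_isDRegular (k : ℕ) : (twoTriangles k).IsDRegular (2 * k + 1) := by
  intro x _
  have h : (twoTriangles k).incidenceSet x =
      {e | e / 7 < twoTrianglesMult k (e % 7) ∧ x ∈ twoTrianglesEnds (e % 7)} := by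
    ext e
    simp only [mem_incidenceSet, Inc, twoTriangles_isLink, exists_and_left, Set.mem_ofPred_eq]
    rfl
  rw [h, encard_setOf_div_lt_mod _ (x ∈ twoTrianglesEnds ·)]
  congr 1
  rw [Finset.sum_filter]
  fin_cases x <;> simp [Finset.sum_range_succ, twoTrianglesEnds, twoTrianglesMult] <;> omega

lemma twoTriangles_edgeConnectivity {k : ℕ} (hk : 1 ≤ k) :
    (twoTriangles k).edgeConnectivity = 1 := by
  have : Nonempty (twoTriangles k).vertexSet := ⟨⟨0, Set.mem_univ _⟩⟩
  refine le_antisymm ?_ (le_sInf ?_)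
  · have hS : (twoTriangles k).IsCrossingSubset {x | x.1 < 3} {6} := by
      intro x hx y hy e he
      have h1 := twoTriangles_isLink.1 he
      -- Only class `6` crosses between the triangles, and its multiplicity `1` forces the index
      -- `0`, so the edge is `6`.
      have h2 : ∀ c < 7, ∀ x y : Fin 6, x < 3 → ¬ y < 3 → twoTrianglesEnds c = s(x, y) → c = 6 := by
        decide
      have h3 := h2 _ (Nat.mod_lt _ (by norm_num)) _ _ hx hy h1.2
      have h4 := h1.1
      rw [h3, twoTrianglesMult] at h4
      · rw [Set.mem_singleton_iff]
        omega
      all_goals omega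
    have := (hS.isDisconnecting (p := ⟨0, Set.mem_univ _⟩) (q := ⟨3, Set.mem_univ _⟩)
      (Set.singleton_subset_iff.2 (IsLink.edge_mem (x := 0) (y := 3)
        (twoTriangles_isLink.2 (by simp [twoTrianglesMult, twoTrianglesEnds]))))
      (by simp) (by simp)).edgeConnectivity_le
    rwa [Set.encard_singleton] at this
  · rintro _ ⟨F, hF, rfl⟩
    rw [Order.one_le_iff_ne_zero, Set.encard_ne_zero, Set.nonempty_iff_ne_empty]
    rintro rfl
    obtain ⟨S, ⟨p, hp⟩, ⟨q, hq⟩, hS⟩ := hF.exists_isCrossingSubset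
    let P : Fin 6 → Prop := fun x => ⟨x, Set.mem_univ _⟩ ∈ S
    -- With no edge removed, membership in `S` is constant along edges. Edge `c < 7` is the edge of
    -- index `0` in class `c`, and the classes `0, 1, 6, 2, 3` form a spanning tree.
    have hlink : ∀ {c : ℕ} {x y : Fin 6}, c < 7 → 0 < twoTrianglesMult k c →
        twoTrianglesEnds c = s(x, y) → (P x ↔ P y) := fun {c x y} hc hm he => by
      have h : (twoTriangles k).IsLink c x y := by
        rw [twoTriangles_isLink, Nat.div_eq_of_lt hc, Nat.mod_eq_of_lt hc]
        exact ⟨hm, he⟩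
      constructor
      · intro hx
        by_contra hy
        exact hS ⟨x, Set.mem_univ _⟩ hx ⟨y, Set.mem_univ _⟩ hy c h
      · intro hy
        by_contra hx
        exact hS ⟨y, Set.mem_univ _⟩ hy ⟨x, Set.mem_univ _⟩ hx c h.symm
    have h1 : P 0 ↔ P 1 := hlink (c := 0) (by norm_num) hk rfl
    have h2 : P 0 ↔ P 2 := hlink (c := 1) (by norm_num) hk rfl
    have h3 : P 0 ↔ P 3 := hlink (c := 6) (by norm_num) Nat.one_pos rfl
    have h4 : P 3 ↔ P 4 := hlink (c := 2) (by norm_num) hk rfl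
    have h5 : P 3 ↔ P 5 := hlink (c := 3) (by norm_num) hk rfl
    have hall : ∀ x, P x ↔ P 0 := fun x => by
      fin_cases x
      exacts [Iff.rfl, h1.symm, h2.symm, h3.symm, (h3.trans h4).symm, (h3.trans h5).symm]
    exact hq ((hall q.1).2 ((hall p.1).1 hp))

end Graph

end

theorem theorem4p2 (d : ℕ) (hd : 1 ≤ d) :
    -- the eigenvalues of `Q` are real, so that its second-largest eigenvalue makes sense
    (∀ n : ℕ, 5 ≤ n → (matrixQ d n).charpoly.Splits) ∧
    -- the spectral bound for edge-connectivity at least two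
    (∀ n : ℕ, 5 ≤ n → ∀ {α β : Type*} (G : Graph α β) [Fintype G.vertexSet] [G.Loopless],
      Fintype.card G.vertexSet = n → G.IsDRegular d → G.lambda2 < rho d n →
        2 ≤ G.edgeConnectivity) ∧
    -- the bound improves the earlier bound
    (∀ n : ℕ, 5 ≤ n → (d : ℝ) - 1 / 3 - 1 / ((n : ℝ) - 3) < rho d n) ∧
    -- the bound is attained by every 6-vertex `d`-regular multigraph of edge-connectivity one
    (3 ≤ d → rho d 6 = ((d : ℝ) - 1 + √(9 * (d : ℝ) ^ 2 - 10 * (d : ℝ) + 17)) / 4 ∧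
      ∀ {α β : Type*} (G : Graph α β) [Fintype G.vertexSet] [G.Loopless],
        Fintype.card G.vertexSet = 6 → G.IsDRegular d → G.edgeConnectivity = 1 →
          G.lambda2 = rho d 6) ∧
    -- and such multigraphs exist for every odd `d ≥ 3`
    (3 ≤ d → Odd d → ∃ G : Graph (Fin 6) ℕ, G.vertexSet = Set.univ ∧ G.Loopless ∧
      G.IsDRegular d ∧ G.edgeConnectivity = 1) := by
  refine ⟨fun n hn => matrixQ_charpoly_splits hd hn, fun n hn α β G _ _ hcard hG hlt => ?_,
    fun n hn => lt_rho hd hn, fun hd3 => ⟨rho_six hd3, fun {α β} G _ _ hcard hG hκ =>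
      Graph.lambda2_eq_rho_six hd3 hcard hG hκ⟩, fun hd3 hodd => ?_⟩
  · by_contra! hκ
    exact absurd hlt (not_lt.2 (Graph.rho_le_lambda2 hd hn hcard hG hκ))
  · obtain ⟨k, rfl⟩ := hodd
    exact ⟨Graph.twoTriangles k, rfl, inferInstance, Graph.twoTriangles_isDRegular k,
      Graph.twoTriangles_edgeConnectivity (by omega)⟩
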